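/- Let $R$ be a commutative Noetherian ring. For a complex $C=(\cdots\to C_{i+1}\to C_i\to C_{i-1}\to\cdots)$ of $R$-modules put $\sup C=\sup\{i\in\mathbb Z: C_i\neq 0\}$, $\inf C=\inf\{i\in\mathbb Z: C_i\neq 0\}$, $\operatorname{hsup} C=\sup\{i\in\mathbb Z: \operatorname{H}_i(C)\neq 0\}$ and $\operatorname{hinf} C=\inf\{i\in\mathbb Z: \operatorname{H}_i(C)\neq 0\}$; $C$ is bounded if $\sup C-\inf C<\infty$. A quasi-injective resolution of an $R$-module $N$ is a complex $I$ of injective $R$-modules with $\sup I<\infty$ for which there are non-negative integers $b_i$ ($i\le\sup I$), not all zero, such that $\operatorname{H}_i(I)\cong N^{\oplus b_i}$ for all $i\leq\sup I$. The quasi-injective dimension of $N\ne 0$ is $$\operatorname{qid}_R N=\inf\{\operatorname{hinf} I-\inf I \mid I \text{ a bounded quasi-injective resolution of } N\},$$ which is $\infty$ if there is no such $I$; and $\operatorname{qid}_R 0=-\infty$. Let $M,N$ be $R$-modules with $\operatorname{qid}_R N<\infty$. Then the following hold. 1. Let $I$ be a quasi-injective resolution of $N$ with $\operatorname{qid}_R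 N=\operatorname{hinf} I-\inf I$, normalized so that $\operatorname{hsup} I\leq 0$ (for example, $\sup I=\operatorname{hsup} I=0$). If, for some integer $n\geq 1$, $\operatorname{Ext}^i_R(M,N)=0$ for all $n\leq i\leq n-\inf I$, then $\operatorname{Ext}^i_R(M,N)=0$ for all $i\geq n$. 2. If $\operatorname{Ext}^i_R(M,N)=0$ for all $i\gg 0$, then $\operatorname{Ext}^i_R(M,N)=0$ for all integers $i\ge 0$ with $i>\operatorname{qid}_R N$. 3. For every ideal $\mathfrak a$ of $R$, the local cohomology $\operatorname{H}^i_{\mathfrak a}(N)$ vanishes for all integers $i\ge 0$ with $i>\operatorname{qid}_R N$. -/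

import Mathlib

open CategoryTheory CategoryTheory.Limits

universe v u

noncomputable section

namespace QuasiInjective

attribute [local instance] Abelian.hasFiniteBiproducts

variable {A : Type u} [Category.{v} A] [Abelian A]

/-- `sup C = sup {i ∈ ℤ | C_i ≠ 0}`, in the extended reals (so `sup 0 = -∞`). -/
def csup (C : ChainComplex A ℤ) : EReal :=
  sSup {x : EReal | ∃ i : ℤ, ¬ IsZero (C.X i) ∧ x = ((i : ℝ) : EReal)}

/-- `inf C = inf {i ∈ ℤ | C_i ≠ 0}`, in the extended reals (so `inf 0 = ∞`). -/
def cinf (C : ChainComplex A ℤ) : EReal :=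
  sInf {x : EReal | ∃ i : ℤ, ¬ IsZero (C.X i) ∧ x = ((i : ℝ) : EReal)}

/-- `hsup C = sup {i ∈ ℤ | H_i(C) ≠ 0}`. -/
def hsup (C : ChainComplex A ℤ) : EReal :=
  sSup {x : EReal | ∃ i : ℤ, ¬ IsZero (C.homology i) ∧ x = ((i : ℝ) : EReal)}

/-- `hinf C = inf {i ∈ ℤ | H_i(C) ≠ 0}`. -/
def hinf (C : ChainComplex A ℤ) : EReal :=
  sInf {x : EReal | ∃ i : ℤ, ¬ IsZero (C.homology i) ∧ x = ((i : ℝ) : EReal)}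

/-- `length C = sup C - inf C`; the zero complex has length `-∞`. -/
def length (C : ChainComplex A ℤ) : EReal := csup C - cinf C

/-- A complex is bounded if its length is less than `∞`. -/
def IsBounded (C : ChainComplex A ℤ) : Prop := length C < ⊤

/-- `I` is a quasi-injective resolution of `M`: a bounded above complex of injective objects such
that, for `i ≤ sup I`, `H_i(I)` is a direct sum of `b i` copies of `M`, the `b i` not all zero. -/
structure IsQuasiInjectiveResolution (I : ChainComplex A ℤ) (M : A) : Prop where
  boundedAbove : csup I < ⊤
  injective : ∀ i : ℤ, Injective (I.X i)
  homology : ∃ b : ℤ → ℕ,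
    (∃ i : ℤ, ((i : ℝ) : EReal) ≤ csup I ∧ b i ≠ 0) ∧
    ∀ i : ℤ, ((i : ℝ) : EReal) ≤ csup I →
      Nonempty (I.homology i ≅ ⨁ (fun _ : Fin (b i) => M))

open Classical in
/-- The quasi-injective dimension: `-∞` for `M = 0`, otherwise the infimum of `hinf I - inf I` over
the bounded quasi-injective resolutions `I` of `M` (so `∞` if there are none). -/
def qid (M : A) : EReal :=
  if IsZero M then ⊥
  else sInf {x : EReal | ∃ I : ChainComplex A ℤ,
    IsQuasiInjectiveResolution I M ∧ IsBounded I ∧ x = hinf I - cinf I}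

end QuasiInjective

end

/-! All three assertions are dimension shifts along one complex `I` of injectives. Call Ext from a
diagram into `Y` eventually zero if each class dies under some transition map. For the constant
diagram at `M` this is ordinary vanishing; for the diagram of the `R ⧸ a ^ n` it forces, in positive
degrees, local cohomology to vanish. The notion passes through long exact sequences, so one argument
serves parts 2 and 3.

The sequences `0 → B_i → Z_i → H_i → 0` and `0 → Z_{i+1} → I_{i+1} → B_i → 0` link the homology,
made of copies of `N`, to the injective terms. At the lowest degree `h` with homology, `Z_h` has
injective dimension at most `h - inf I`. If Ext into `N` vanishes in all degrees above some `e > h -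
inf I`, then `Ext^{e+1}` into `B_h` vanishes too, hence so does `Ext^e` into `H_h` and into its
summand `N`: descending induction on `e` (`of_boundedComplex`). At the highest degree `t` with
homology, Ext into `B_t` vanishes in positive degrees, and a window of vanishing climbs from `inf I`
up to `Z_t`, which gives the next degree for `N` (`of_window`).

The descent needs a starting degree. Part 2 assumes one; for part 3 it comes from induction on the
generators of `a` (`exists_forall_extEventuallyZero`). -/

section EventuallyZero

open Abelian

variable {C : Type*} [Category* C] [Abelian C] [HasExt C] {J : Type*} [Category* J] (D : J ⥤ C)

/-- Every class in `Ext (D.obj j) Y i` is killed by some transition map of the diagram `D`: when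
`J` is cofiltered this says that the colimit of the groups `Ext (D.obj j) Y i` vanishes. -/
def CategoryTheory.Functor.ExtEventuallyZero (i : ℕ) (Y : C) : Prop :=
  ∀ (j : J) (ξ : Ext (D.obj j) Y i), ∃ (k : J) (f : k ⟶ j),
    (Ext.mk₀ (D.map f)).comp ξ (zero_add i) = 0

/-! ### Long exact sequences for eventual vanishing. -/

namespace CategoryTheory.Functor.ExtEventuallyZero

variable {D} {i : ℕ} {Y : C}

lemma of_isZero (hY : IsZero Y) : D.ExtEventuallyZero i Y := fun j ξ ↦
  ⟨j, 𝟙 j, by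
    rw [← Ext.comp_mk₀_id ξ, hY.eq_of_src (𝟙 Y) 0, Ext.mk₀_zero, Ext.comp_zero, Ext.comp_zero]⟩

lemma of_injective (hi : 1 ≤ i) [Injective Y] : D.ExtEventuallyZero i Y := fun j ξ ↦ by
  obtain ⟨i, rfl⟩ := Nat.exists_eq_add_of_le' hi
  exact ⟨j, 𝟙 j, by rw [ξ.eq_zero_of_injective, Ext.comp_zero]⟩

lemma of_retract {Y' : C} (r : Retract Y Y') (h : D.ExtEventuallyZero i Y') :
    D.ExtEventuallyZero i Y := fun j ξ ↦ by
  obtain ⟨k, f, hf⟩ := h j (ξ.comp (Ext.mk₀ r.i) (add_zero i))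
  refine ⟨k, f, ?_⟩
  have h1 : (ξ.comp (Ext.mk₀ r.i) (add_zero i)).comp (Ext.mk₀ r.r) (add_zero i) = ξ := by
    rw [Ext.comp_assoc_of_third_deg_zero, Ext.mk₀_comp_mk₀, r.retract, Ext.comp_mk₀_id]
  rw [← h1, ← Ext.comp_assoc_of_third_deg_zero, hf, Ext.zero_comp]

lemma of_iso {Y' : C} (e : Y ≅ Y') (h : D.ExtEventuallyZero i Y') :
    D.ExtEventuallyZero i Y :=
  h.of_retract ⟨e.hom, e.inv, e.hom_inv_id⟩

/-- One transition lifts the class along the long exact sequence and a second one, starting where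
the first ended, kills the lift. Composing transitions in this way avoids any cofilteredness
assumption on `J`. -/
lemma middle {S : ShortComplex C} (hS : S.ShortExact) (h₁ : D.ExtEventuallyZero i S.X₁)
    (h₃ : D.ExtEventuallyZero i S.X₃) : D.ExtEventuallyZero i S.X₂ := fun j ξ ↦ by
  obtain ⟨k, f, hf⟩ := h₃ j (ξ.comp (Ext.mk₀ S.g) (add_zero i))
  rw [← Ext.comp_assoc_of_third_deg_zero] at hf
  obtain ⟨η, hη⟩ := Ext.covariant_sequence_exact₂ _ hS _ hf
  obtain ⟨l, g, hg⟩ := h₁ k η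
  refine ⟨l, g ≫ f, ?_⟩
  rw [D.map_comp, ← Ext.mk₀_comp_mk₀_assoc, ← hη, ← Ext.comp_assoc_of_third_deg_zero, hg,
    Ext.zero_comp]

lemma right {S : ShortComplex C} (hS : S.ShortExact) (h₂ : D.ExtEventuallyZero i S.X₂)
    (h₁ : D.ExtEventuallyZero (i + 1) S.X₁) : D.ExtEventuallyZero i S.X₃ := fun j ξ ↦ by
  obtain ⟨k, f, hf⟩ := h₁ j (ξ.comp hS.extClass rfl)
  rw [← Ext.comp_assoc _ _ _ (zero_add i) rfl (by omega)] at hf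
  obtain ⟨η, hη⟩ := Ext.covariant_sequence_exact₃ _ hS _ _ hf
  obtain ⟨l, g, hg⟩ := h₂ k η
  refine ⟨l, g ≫ f, ?_⟩
  rw [D.map_comp, ← Ext.mk₀_comp_mk₀_assoc, ← hη, ← Ext.comp_assoc_of_third_deg_zero, hg,
    Ext.zero_comp]

lemma left {S : ShortComplex C} (hS : S.ShortExact) (h₃ : D.ExtEventuallyZero i S.X₃)
    (h₂ : D.ExtEventuallyZero (i + 1) S.X₂) : D.ExtEventuallyZero (i + 1) S.X₁ := fun j ξ ↦ by
  obtain ⟨k, f, hf⟩ := h₂ j (ξ.comp (Ext.mk₀ S.f) (add_zero _))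
  rw [← Ext.comp_assoc_of_third_deg_zero] at hf
  obtain ⟨η, hη⟩ := Ext.covariant_sequence_exact₁ _ hS _ hf rfl
  obtain ⟨l, g, hg⟩ := h₃ k η
  refine ⟨l, g ≫ f, ?_⟩
  rw [D.map_comp, ← Ext.mk₀_comp_mk₀_assoc, ← hη,
    ← Ext.comp_assoc _ _ _ (zero_add i) rfl (by omega), hg, Ext.zero_comp]

/-- For finite biproducts, a single transition has to kill all components. They are killed one after
another, and those already zero stay zero. -/
lemma exists_forall_comp_eq_zero {ι : Type*} {F : ι → C}
    (h : ∀ a, D.ExtEventuallyZero i (F a)) (p : ∀ a, Y ⟶ F a) (s : Finset ι) (j : J)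
    (ξ : Ext (D.obj j) Y i) : ∃ (k : J) (f : k ⟶ j), ∀ a ∈ s,
      ((Ext.mk₀ (D.map f)).comp ξ (zero_add i)).comp (Ext.mk₀ (p a)) (add_zero i) = 0 := by
  classical
  induction s using Finset.induction_on with
  | empty => exact ⟨j, 𝟙 j, by simp⟩
  | insert a s ha ih =>
    obtain ⟨k, f, hf⟩ := ih
    obtain ⟨l, g, hg⟩ := h a k
      (((Ext.mk₀ (D.map f)).comp ξ (zero_add i)).comp (Ext.mk₀ (p a)) (add_zero i))
    refine ⟨l, g ≫ f, fun b hb ↦ ?_⟩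
    rw [D.map_comp, ← Ext.mk₀_comp_mk₀_assoc, Ext.comp_assoc_of_third_deg_zero]
    obtain rfl | hb := Finset.mem_insert.1 hb
    · exact hg
    · rw [hf b hb, Ext.comp_zero]

lemma biproduct {ι : Type} [Fintype ι] {F : ι → C} [HasBiproduct F]
    (h : ∀ a, D.ExtEventuallyZero i (F a)) : D.ExtEventuallyZero i (⨁ F) := fun j ξ ↦ by
  obtain ⟨k, f, hf⟩ := exists_forall_comp_eq_zero h (biproduct.π F) Finset.univ j ξ
  refine ⟨k, f, (Ext.addEquivBiproduct _ (biproduct.isBilimit F) i).injective ?_⟩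
  rw [map_zero]
  ext a
  exact hf a (Finset.mem_univ a)

lemma of_biproduct {ι : Type} [Fintype ι] {F : ι → C} [HasBiproduct F]
    (h : D.ExtEventuallyZero i (⨁ F)) (a : ι) : D.ExtEventuallyZero i (F a) :=
  h.of_retract ⟨biproduct.ι F a, biproduct.π F a, by simp⟩

end CategoryTheory.Functor.ExtEventuallyZero

lemma CategoryTheory.Functor.extEventuallyZero_const_iff [Nonempty J] (M Y : C) (i : ℕ) :
    ((Functor.const J).obj M).ExtEventuallyZero i Y ↔ Subsingleton (Ext M Y i) := by
  constructor
  · intro h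
    refine subsingleton_of_forall_eq 0 fun ξ ↦ ?_
    obtain ⟨k, f, hf⟩ := h (Classical.arbitrary J) ξ
    simpa using hf
  · exact fun h j ξ ↦ ⟨j, 𝟙 j, h.elim _ _⟩

end EventuallyZero

/-! ### Cycles, boundaries and homology. -/

namespace ChainComplex

variable {C : Type*} [Category* C] [Abelian C] (I : ChainComplex C ℤ)

/-- The boundaries of a complex, as the kernel of the projection from cycles to homology. -/
noncomputable abbrev boundaries (i : ℤ) : C := kernel (I.homologyπ i)

/-- The sequence `0 ⟶ Bᵢ ⟶ Zᵢ ⟶ Hᵢ ⟶ 0`. -/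
noncomputable abbrev boundariesCyclesHomology (i : ℤ) : ShortComplex C :=
  ShortComplex.mk (kernel.ι (I.homologyπ i)) (I.homologyπ i) (kernel.condition _)

lemma boundariesCyclesHomology_shortExact (i : ℤ) :
    (I.boundariesCyclesHomology i).ShortExact where
  exact := ShortComplex.exact_kernel _

/-- The sequence `0 ⟶ Zᵢ₊₁ ⟶ Iᵢ₊₁ ⟶ Bᵢ ⟶ 0`. -/
noncomputable abbrev cyclesXBoundaries (i : ℤ) : ShortComplex C :=
  ShortComplex.mk (I.iCycles (i + 1))
    (kernel.lift (I.homologyπ i) (I.toCycles (i + 1) i) (by simp)) (by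
      rw [← cancel_mono (kernel.ι _), ← cancel_mono (I.iCycles i)]
      simp)

lemma cyclesXBoundaries_shortExact (i : ℤ) : (I.cyclesXBoundaries i).ShortExact where
  exact := by
    refine ShortComplex.exact_of_f_is_kernel _ ?_
    refine KernelFork.IsLimit.ofι' _ _ fun {A} k hk ↦
      ⟨I.liftCycles k i (by simp) (?_ : k ≫ I.d (i + 1) i = 0), I.liftCycles_i _ _ _ _⟩
    rw [← cancel_mono (kernel.ι _), ← cancel_mono (I.iCycles i)] at hk
    simpa using hk
  epi_g := ShortComplex.Exact.epi_kernelLift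
    (S := ShortComplex.mk (I.toCycles (i + 1) i) (I.homologyπ i) (by simp))
    (ShortComplex.exact_of_g_is_cokernel _ (I.homologyIsCokernel (i + 1) i (by simp)))

variable {I}

lemma isZero_cycles {i : ℤ} (h : IsZero (I.X i)) : IsZero (I.cycles i) :=
  h.of_mono (I.iCycles i)

lemma isZero_homology {i : ℤ} (h : IsZero (I.X i)) : IsZero (I.homology i) :=
  (isZero_cycles h).of_epi (I.homologyπ i)

lemma isZero_boundaries {i : ℤ} (h : IsZero (I.X i)) : IsZero (I.boundaries i) :=
  (isZero_cycles h).of_mono (kernel.ι _)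

lemma isZero_boundaries_of_succ {i : ℤ} (h : IsZero (I.X (i + 1))) : IsZero (I.boundaries i) :=
  have := (I.cyclesXBoundaries_shortExact i).epi_g
  h.of_epi (I.cyclesXBoundaries i).g

end ChainComplex

/-! ### Dimension shifting along complexes of injectives. -/

section BoundedComplexes

variable {C : Type*} [Category* C] [Abelian C] [HasExt C] {J : Type*} [Category* J] {D : J ⥤ C}
  {I : ChainComplex C ℤ} {k : ℕ} {i : ℤ}

open ChainComplex

namespace CategoryTheory.Functor.ExtEventuallyZero

lemma cycles (h₁ : D.ExtEventuallyZero k (I.boundaries i))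
    (h₃ : D.ExtEventuallyZero k (I.homology i)) : D.ExtEventuallyZero k (I.cycles i) :=
  middle (I.boundariesCyclesHomology_shortExact i) h₁ h₃

lemma homology (h₂ : D.ExtEventuallyZero k (I.cycles i))
    (h₁ : D.ExtEventuallyZero (k + 1) (I.boundaries i)) :
    D.ExtEventuallyZero k (I.homology i) :=
  right (I.boundariesCyclesHomology_shortExact i) h₂ h₁

lemma boundaries (h₃ : D.ExtEventuallyZero k (I.homology i))
    (h₂ : D.ExtEventuallyZero (k + 1) (I.cycles i)) :
    D.ExtEventuallyZero (k + 1) (I.boundaries i) :=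
  left (I.boundariesCyclesHomology_shortExact i) h₃ h₂

variable [∀ i, Injective (I.X i)]

lemma boundaries_of_cycles_succ (hk : 1 ≤ k)
    (h : D.ExtEventuallyZero (k + 1) (I.cycles (i + 1))) :
    D.ExtEventuallyZero k (I.boundaries i) :=
  right (I.cyclesXBoundaries_shortExact i) (of_injective hk) h

lemma cycles_succ (h : D.ExtEventuallyZero k (I.boundaries i)) :
    D.ExtEventuallyZero (k + 1) (I.cycles (i + 1)) :=
  left (I.cyclesXBoundaries_shortExact i) h (of_injective (by omega))

/-- Descending induction: in a complex of injectives which vanishes above `s`, eventual vanishing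
of `Ext` into the homology above `j` in degrees `> e` passes to the boundaries in degree `j`. -/
lemma boundaries_of_homology_above {s : ℤ} (hs : ∀ i, s < i → IsZero (I.X i)) (e : ℕ) (j : ℤ)
    (h : ∀ i, j < i → ∀ k : ℕ, e < k → D.ExtEventuallyZero k (I.homology i))
    (k : ℕ) (hk : e < k) : D.ExtEventuallyZero k (I.boundaries j) := by
  obtain hj | hj := lt_or_ge s (j + 1)
  · exact of_isZero (isZero_boundaries_of_succ (hs _ hj))
  · exact boundaries_of_cycles_succ (by omega)
      (cycles (boundaries_of_homology_above hs e (j + 1) (fun i hi ↦ h i (by omega))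
        (k + 1) (by omega)) (h _ (by omega) _ (by omega)))
termination_by (s - j).toNat

/-- Dimension shifting: the cycles in degree `j` of a complex of injectives vanishing below `l`
have injective dimension at most `j - l` if there is no homology below `j`. -/
lemma cycles_of_isZero_homology_below {l : ℤ} (hl : ∀ i, i < l → IsZero (I.X i)) (j : ℤ)
    (h : ∀ i, i < j → IsZero (I.homology i)) (k : ℕ) (hk : j - l < k) :
    D.ExtEventuallyZero k (I.cycles j) := by
  obtain hj | hj := lt_or_ge j l
  · exact of_isZero (isZero_cycles (hl _ hj))
  obtain ⟨j, rfl⟩ : ∃ j', j = j' + 1 := ⟨j - 1, by omega⟩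
  obtain ⟨k, rfl⟩ := Nat.exists_eq_add_of_le' (show 1 ≤ k by omega)
  refine cycles_succ ?_
  obtain hj' | hj' := lt_or_ge j l
  · exact of_isZero (isZero_boundaries (hl _ hj'))
  obtain ⟨k, rfl⟩ := Nat.exists_eq_add_of_le' (show 1 ≤ k by omega)
  exact boundaries (of_isZero (h _ (by omega)))
    (cycles_of_isZero_homology_below hl j (fun i hi ↦ h i (by omega)) _ (by push_cast at *; omega))
termination_by (j - l + 1).toNat

variable {N : C} {s l : ℤ}

/-- If `Ext` into `N` vanishes eventually in all large degrees, and a complex of injectives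
vanishing outside `[l, s]` has all homology built from `N`, then the vanishing holds in degrees
`> h - l`, where `h` is the lowest degree with non-zero homology. -/
lemma of_boundedComplex (hs : ∀ i, s < i → IsZero (I.X i)) (hl : ∀ i, i < l → IsZero (I.X i))
    (hH : ∀ i k, D.ExtEventuallyZero k N → D.ExtEventuallyZero k (I.homology i)) {h : ℤ}
    (hh : ∀ i, i < h → IsZero (I.homology i))
    (hN : ∀ k, D.ExtEventuallyZero k (I.homology h) → D.ExtEventuallyZero k N)
    {m : ℕ} (hm : ∀ k, m ≤ k → D.ExtEventuallyZero k N) {e : ℕ} (he : h - l < e) :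
    D.ExtEventuallyZero e N := by
  obtain hem | hem := le_or_gt m e
  · exact hm e hem
  -- Ext into `H_h` in degree `e` sits between degree `e` of `Z_h`, zero since `e > h - l`, and
  -- degree `e + 1` of `B_h`, which involves `N` only in degrees `> e`.
  refine hN e (homology (cycles_of_isZero_homology_below hl h hh e he)
    (boundaries_of_homology_above hs e h (fun i _ k hk ↦ hH i k ?_) (e + 1) (by omega)))
  exact of_boundedComplex hs hl hH hh hN hm (e := k) (by omega)
termination_by m - e

/-- Vanishing along a bounded complex of injectives, in a window of degrees. -/
lemma cycles_of_window (hl : ∀ i, i < l → IsZero (I.X i))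
    (hH : ∀ i k, D.ExtEventuallyZero k N → D.ExtEventuallyZero k (I.homology i)) {t : ℤ}
    (ht : t ≤ 0) {n : ℕ} (hn : 1 ≤ n)
    (hN : ∀ k : ℕ, n ≤ k → (k : ℤ) ≤ n - l → D.ExtEventuallyZero k N) (j : ℤ) (hj : j ≤ t)
    (k : ℕ) (hk : (k : ℤ) = n - l + 1 + j - t) : D.ExtEventuallyZero k (I.cycles j) := by
  obtain hj | hj := lt_or_ge j l
  · exact of_isZero (isZero_cycles (hl _ hj))
  obtain ⟨j, rfl⟩ : ∃ j', j = j' + 1 := ⟨j - 1, by omega⟩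
  obtain ⟨k, rfl⟩ := Nat.exists_eq_add_of_le' (show 1 ≤ k by omega)
  refine cycles_succ ?_
  obtain hj' | hj' := lt_or_ge j l
  · exact of_isZero (isZero_boundaries (hl _ hj'))
  obtain ⟨k, rfl⟩ := Nat.exists_eq_add_of_le' (show 1 ≤ k by omega)
  -- Here `k = n - l + j - t` with `l ≤ j < t ≤ 0`, so `n ≤ k < n - l` and the homology in degree
  -- `j` is covered by the window.
  exact boundaries (hH _ _ (hN _ (by omega) (by omega)))
    (cycles_of_window hl hH ht hn hN j (by omega) _ (by push_cast at *; omega))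
termination_by (j - l + 1).toNat

/-- Rigidity: if `Ext` into `N` vanishes eventually in the degrees `n ≤ k ≤ n - l`, and a complex
of injectives vanishing outside `[l, s]` has all homology built from `N` and concentrated in
degrees `≤ 0`, then the vanishing holds in all degrees `≥ n`. -/
lemma of_window (hs : ∀ i, s < i → IsZero (I.X i)) (hl : ∀ i, i < l → IsZero (I.X i))
    (hH : ∀ i k, D.ExtEventuallyZero k N → D.ExtEventuallyZero k (I.homology i)) {t : ℤ}
    (ht : t ≤ 0) (htop : ∀ i, t < i → IsZero (I.homology i))
    (hN : ∀ k, D.ExtEventuallyZero k (I.homology t) → D.ExtEventuallyZero k N)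
    {n : ℕ} (hn : 1 ≤ n)
    (hw : ∀ k : ℕ, n ≤ k → (k : ℤ) ≤ n - l → D.ExtEventuallyZero k N) (k : ℕ) (hk : n ≤ k) :
    D.ExtEventuallyZero k N := by
  induction k using Nat.strong_induction_on with
  | _ k ih =>
    obtain hkl | hkl := le_or_gt (k : ℤ) (n - l)
    · exact hw k hk hkl
    -- The window is slid up to end at `n' - l = k - 1`; `k > n - l` ensures `n' ≥ n`, so the
    -- inductive hypothesis covers it.
    obtain ⟨n', hn'⟩ : ∃ n' : ℕ, (n' : ℤ) = k - 1 + l := ⟨(k - 1 + l).toNat, by omega⟩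
    refine hN k (homology (cycles_of_window hl hH ht (n := n') (by omega)
      (fun k' h₁ h₂ ↦ ih k' (by omega) (by omega)) t le_rfl k (by omega)) ?_)
    -- There is no homology above `t`, so Ext into `B_t` vanishes in every positive degree.
    exact boundaries_of_homology_above hs 0 t (fun i hi _ _ ↦ of_isZero (htop i hi)) _ (by omega)

end CategoryTheory.Functor.ExtEventuallyZero

end BoundedComplexes

/-! ### Eventual vanishing for `R ⧸ a ^ n` in large degrees. -/

namespace Ideal

open Abelian

variable {R : Type u} [CommRing R]

/-- The projection `R ⧸ J' ⟶ R ⧸ J` for `J' ≤ J`. -/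
abbrev quotientProj {J' J : Ideal R} (h : J' ≤ J) :
    ModuleCat.of R (R ⧸ J') ⟶ ModuleCat.of R (R ⧸ J) :=
  ModuleCat.ofHom (Submodule.factor h)

lemma quotientProj_comp {J'' J' J : Ideal R} (h : J'' ≤ J') (h' : J' ≤ J) :
    quotientProj h ≫ quotientProj h' = quotientProj (h.trans h') := by
  ext
  rfl

/-- The sequence `0 ⟶ J / J' ⟶ R / J' ⟶ R / J ⟶ 0`. -/
abbrev quotientShortComplex {J' J : Ideal R} (h : J' ≤ J) : ShortComplex (ModuleCat.{u} R) :=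
  ShortComplex.mk (ModuleCat.ofHom (LinearMap.ker (Submodule.factor h)).subtype)
    (quotientProj h) (by ext x; exact x.2)

lemma quotientShortComplex_shortExact {J' J : Ideal R} (h : J' ≤ J) :
    (quotientShortComplex h).ShortExact where
  exact := by
    rw [ShortComplex.moduleCat_exact_iff]
    intro x hx
    exact ⟨⟨x, hx⟩, rfl⟩
  mono_f := (ModuleCat.mono_iff_injective _).2 Subtype.val_injective
  epi_g := (ModuleCat.epi_iff_surjective _).2 (Submodule.factor_surjective h)

/-- Functoriality of `quotientShortComplex`. -/
def quotientShortComplexMap {J₁' J₁ J₂' J₂ : Ideal R} (h₁ : J₁' ≤ J₁) (h₂ : J₂' ≤ J₂)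
    (h' : J₁' ≤ J₂') (h : J₁ ≤ J₂) : quotientShortComplex h₁ ⟶ quotientShortComplex h₂ where
  τ₁ := ModuleCat.ofHom ((Submodule.factor h').restrict (by
    rintro ⟨x⟩ hx
    exact (Submodule.Quotient.mk_eq_zero J₂).2
      (h ((Submodule.Quotient.mk_eq_zero J₁).1 hx))))
  τ₂ := quotientProj h'
  τ₃ := quotientProj h
  comm₁₂ := by ext x; rfl
  comm₂₃ := by ext; rfl

/-- Multiplication by `y` as a map from `R ⧸ J'` to `J ⧸ J'`, for `y ∈ J`. -/
def mulToKer {J' J : Ideal R} (h : J' ≤ J) (y : R) (hy : y ∈ J) :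
    (R ⧸ J') →ₗ[R] LinearMap.ker (Submodule.factor h) :=
  (LinearMap.lsmul R (R ⧸ J') y).codRestrict _ (by
    rintro ⟨x⟩
    exact (Submodule.Quotient.mk_eq_zero J).2 (J.mul_mem_right x hy))

lemma mulToKer_surjective {J : Ideal R} {y : R} :
    Function.Surjective (mulToKer (J' := J) (le_sup_left : J ≤ J ⊔ span {y}) y
      (mem_sup_right (mem_span_singleton_self y))) := by
  rintro ⟨⟨x⟩, hx⟩
  obtain ⟨a, ha, b, hb, rfl⟩ := Submodule.mem_sup.1 ((Submodule.Quotient.mk_eq_zero _).1 hx)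
  obtain ⟨c, rfl⟩ := mem_span_singleton'.1 hb
  refine ⟨Submodule.Quotient.mk c, Subtype.ext ((Submodule.Quotient.eq J).2 ?_)⟩
  simpa [mul_comm] using J.neg_mem ha

/-- If `J : x ^ (n + p) = J : x ^ p`, then division by `x ^ n` is a well defined map from
`x ^ (n + p) (R / J)` to `R / J`. -/
lemma exists_division {J : Ideal R} {x : R} {n p : ℕ}
    (hp : ∀ u, x ^ (n + p) * u ∈ J → x ^ p * u ∈ J) :
    ∃ q : LinearMap.ker (Submodule.factor (le_sup_left : J ≤ J ⊔ span {x ^ (n + p)})) →ₗ[R] (R ⧸ J),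
      ∀ z, x ^ n • q z = z.1 := by
  set π := mulToKer (J' := J) (le_sup_left : J ≤ J ⊔ span {x ^ (n + p)}) (x ^ (n + p))
      (mem_sup_right (mem_span_singleton_self _))
  have hker : LinearMap.ker π ≤ LinearMap.ker (LinearMap.lsmul R (R ⧸ J) (x ^ p)) := by
    rintro ⟨u⟩ hu
    have hu' : (x ^ (n + p) * u) ∈ J :=
      (Submodule.Quotient.mk_eq_zero J).1 (congrArg Subtype.val (LinearMap.mem_ker.1 hu))
    exact (Submodule.Quotient.mk_eq_zero J).2 (hp u hu')
  refine ⟨(LinearMap.ker π).liftQ _ hker ∘ₗ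
    (π.quotKerEquivOfSurjective mulToKer_surjective).symm.toLinearMap, fun z ↦ ?_⟩
  obtain ⟨u, rfl⟩ := mulToKer_surjective z
  have : (π.quotKerEquivOfSurjective mulToKer_surjective).symm (π u) =
      Submodule.Quotient.mk u := by
    rw [LinearEquiv.symm_apply_eq]
    rfl
  change x ^ n • (LinearMap.ker π).liftQ _ hker
    ((π.quotKerEquivOfSurjective mulToKer_surjective).symm (π u)) = _
  rw [this]
  change x ^ n • x ^ p • u = x ^ (n + p) • u
  rw [smul_smul, pow_add]

/-- The colon ideals `J : x ^ p` ascend with `p`, hence stabilize. -/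
lemma exists_forall_pow_mul_mem [IsNoetherianRing R] (J : Ideal R) (x : R) (n : ℕ) :
    ∃ p, ∀ u, x ^ (n + p) * u ∈ J → x ^ p * u ∈ J := by
  let f : ℕ →o Ideal R :=
    { toFun := fun p ↦ LinearMap.ker (J.mkQ ∘ₗ LinearMap.lsmul R R (x ^ p))
      monotone' := by
        intro p q hpq u hu
        obtain ⟨r, rfl⟩ := Nat.exists_eq_add_of_le' hpq
        simp only [LinearMap.mem_ker, LinearMap.comp_apply, Submodule.mkQ_apply,
          Submodule.Quotient.mk_eq_zero, LinearMap.lsmul_apply, smul_eq_mul] at hu ⊢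
        rw [pow_add, mul_assoc]
        exact J.mul_mem_left _ hu }
  obtain ⟨p, hp⟩ := monotone_stabilizes_iff_noetherian.2 ‹IsNoetherianRing R› f
  refine ⟨p, fun u hu ↦ ?_⟩
  have h := hp (n + p) (by omega)
  have hu' : u ∈ f (n + p) := (Submodule.Quotient.mk_eq_zero J).2 hu
  rw [← h] at hu'
  exact (Submodule.Quotient.mk_eq_zero J).1 hu'

/-- Classes of degree `i` in `Ext (R ⧸ J) N`, for `J` containing a power of `b`, are killed by
restriction to a smaller such `J`. -/
def ExtEffaceable (b : Ideal R) (N : ModuleCat.{u} R) (i : ℕ) : Prop :=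
  ∀ J : Ideal R, (∃ n, b ^ n ≤ J) → ∀ ξ : Ext (ModuleCat.of R (R ⧸ J)) N i,
    ∃ (J' : Ideal R) (h : J' ≤ J), (∃ n, b ^ n ≤ J') ∧
      (Ext.mk₀ (quotientProj h)).comp ξ (zero_add i) = 0

lemma extEffaceable_bot (N : ModuleCat.{u} R) (i : ℕ) (hi : 1 ≤ i) :
    (⊥ : Ideal R).ExtEffaceable N i := by
  intro J _ ξ
  obtain ⟨i, rfl⟩ := Nat.exists_eq_add_of_le' hi
  have : Module.Projective R (R ⧸ (⊥ : Ideal R)) :=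
    Module.Projective.of_equiv (Submodule.quotEquivOfEqBot (⊥ : Ideal R) rfl).symm
  have : Projective (ModuleCat.of R (R ⧸ (⊥ : Ideal R))) :=
    (IsProjective.iff_projective _).1 this
  exact ⟨⊥, bot_le, ⟨1, by simp⟩, Ext.eq_zero_of_projective _⟩

/-- Adjoining a generator raises the degrees of non-vanishing by at most one. -/
lemma ExtEffaceable.sup_span_singleton [IsNoetherianRing R] {b : Ideal R} {N : ModuleCat.{u} R}
    {i : ℕ} (hb : b.ExtEffaceable N i) (hb' : b.ExtEffaceable N (i + 1)) (x : R) :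
    (span {x} ⊔ b).ExtEffaceable N (i + 1) := by
  rintro J ⟨n, hn⟩ ξ
  have hxJ : x ^ n ∈ J := hn (pow_mem_pow (mem_sup_left (mem_span_singleton_self x)) n)
  have hbJ : b ^ n ≤ J := (pow_right_mono le_sup_right n).trans hn
  obtain ⟨J₂, h₂, ⟨n₂, hn₂⟩, hξ₂⟩ := hb' J ⟨n, hbJ⟩ ξ
  set J₃ := J₂ ⊔ span {x ^ n}
  have h₂₃ : J₂ ≤ J₃ := le_sup_left
  have h₃ : J₃ ≤ J := sup_le h₂ ((span_singleton_le_iff_mem _).2 hxJ)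
  -- The class dies on `R ⧸ J₂`, so its restriction to `R ⧸ J₃` is the connecting image of some `η`
  -- on `J₃ / J₂ = x ^ n (R ⧸ J₂)`. Pulled back along multiplication by `x ^ n`, `η` lives on `R ⧸
  -- J₂`, where the hypothesis in degree `i` applies.
  obtain ⟨η, hη⟩ := Ext.contravariant_sequence_exact₃ (quotientShortComplex_shortExact h₂₃) N
    ((Ext.mk₀ (quotientProj h₃)).comp ξ (zero_add _))
    (by rw [Ext.mk₀_comp_mk₀_assoc, quotientProj_comp, hξ₂]) (add_comm 1 i)
  obtain ⟨J₄, h₄, ⟨n₄, hn₄⟩, hη₄⟩ := hb J₂ ⟨n₂, hn₂⟩ ((Ext.mk₀ (ModuleCat.ofHom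
    (mulToKer h₂₃ (x ^ n) (mem_sup_right (mem_span_singleton_self _))))).comp η (zero_add i))
  obtain ⟨p, hp⟩ := exists_forall_pow_mul_mem J₄ x n
  obtain ⟨q, hq⟩ := exists_division hp
  set J₅ := J₄ ⊔ span {x ^ (n + p)}
  have h₄₅ : J₄ ≤ J₅ := le_sup_left
  have h₅₃ : J₅ ≤ J₃ := sup_le_sup h₄ (by
    rw [span_singleton_le_span_singleton]
    exact pow_dvd_pow x (by omega))
  refine ⟨J₅, h₅₃.trans h₃, ⟨n₄ + (n + p), ?_⟩, ?_⟩
  · calc (span {x} ⊔ b) ^ (n₄ + (n + p)) ≤ span {x} ^ (n + p) ⊔ b ^ n₄ := by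
          rw [add_comm]; exact sup_pow_add_le_pow_sup_pow
      _ ≤ J₅ := sup_le (by rw [span_singleton_pow]; exact le_sup_right) (hn₄.trans le_sup_left)
  let φ := quotientShortComplexMap h₄₅ h₂₃ h₄ h₅₃
  -- The map `J₅ / J₄ → J₃ / J₂` divides by `x ^ n`, projects `R ⧸ J₄ → R ⧸ J₂`, and multiplies
  -- back. Since `η` dies on `R ⧸ J₄`, it dies on `J₅ / J₄`.
  have hφ : φ.τ₁ = ModuleCat.ofHom q ≫ quotientProj h₄ ≫ ModuleCat.ofHom
      (mulToKer h₂₃ (x ^ n) (mem_sup_right (mem_span_singleton_self _))) := by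
    ext z
    change Submodule.factor h₄ z.1 = x ^ n • Submodule.factor h₄ (q z)
    rw [← map_smul, hq]
  have hη₅ : (Ext.mk₀ φ.τ₁).comp η (zero_add i) = 0 := by
    rw [hφ, ← Ext.mk₀_comp_mk₀_assoc, ← Ext.mk₀_comp_mk₀_assoc, hη₄, Ext.comp_zero]
  rw [← quotientProj_comp h₅₃ h₃, ← Ext.mk₀_comp_mk₀_assoc, ← hη]
  have := ShortComplex.ShortExact.extClass_naturality (quotientShortComplex_shortExact h₄₅)
    (quotientShortComplex_shortExact h₂₃) φ
  change (Ext.mk₀ φ.τ₃).comp _ _ = 0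
  rw [← Ext.comp_assoc _ _ _ (zero_add 1) _ (by omega), ← this,
    Ext.comp_assoc _ _ _ (add_zero 1) (zero_add i) (by omega), hη₅, Ext.comp_zero]

lemma exists_forall_extEffaceable [IsNoetherianRing R] (a : Ideal R) (N : ModuleCat.{u} R) :
    ∃ r, ∀ i, r < i → a.ExtEffaceable N i := by
  classical
  obtain ⟨s, rfl⟩ := IsNoetherian.noetherian a
  induction s using Finset.induction_on with
  | empty =>
    refine ⟨0, fun i hi ↦ ?_⟩
    rw [Finset.coe_empty, Submodule.span_empty]
    exact extEffaceable_bot N i hi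
  | insert x s _ ih =>
    obtain ⟨r, hr⟩ := ih
    refine ⟨r + 1, fun i hi ↦ ?_⟩
    obtain ⟨i, rfl⟩ := Nat.exists_eq_add_of_le' (show 1 ≤ i by omega)
    rw [Finset.coe_insert, Submodule.span_insert]
    exact (hr i (by omega)).sup_span_singleton (hr (i + 1) (by omega)) x

lemma exists_forall_extEventuallyZero [IsNoetherianRing R] (a : Ideal R) (N : ModuleCat.{u} R) :
    ∃ r, ∀ i, r ≤ i → (localCohomology.ringModIdeals
      (localCohomology.idealPowersDiagram a)).ExtEventuallyZero i N := by
  obtain ⟨r, hr⟩ := exists_forall_extEffaceable a N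
  refine ⟨r + 1, fun i hi j ξ ↦ ?_⟩
  obtain ⟨J, hJ, ⟨n, hn⟩, h⟩ := hr i hi (a ^ j.unop) ⟨_, le_rfl⟩ ξ
  -- The summand `j` makes the index a refinement of `j`; the summand `n` puts the power inside `J`.
  refine ⟨Opposite.op (j.unop + n), (homOfLE (Nat.le_add_right _ _)).op, ?_⟩
  have hnJ : a ^ (j.unop + n) ≤ J := (pow_le_pow_right (Nat.le_add_left _ _)).trans hn
  have : (localCohomology.ringModIdeals (localCohomology.idealPowersDiagram a)).map
      (homOfLE (Nat.le_add_right j.unop n)).op = quotientProj hnJ ≫ quotientProj hJ := by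
    rw [quotientProj_comp]
    rfl
  rw [this]
  refine (Ext.mk₀_comp_mk₀_assoc (quotientProj hnJ) (quotientProj hJ) ξ).symm.trans ?_
  rw [h]
  exact Ext.comp_zero _ _ _ _ _

end Ideal

/-! ### Derived-functor Ext and `Abelian.Ext` through cocycles. -/

section Comparison

open Opposite

variable {R : Type u} [CommRing R] {X X' Y : ModuleCat.{u} R} {i : ℕ}

/-- The complex `Hom(P, Y)`, as a chain complex in the opposite category, whose homology is the
derived functor `Ext R (ModuleCat R) i`. -/
noncomputable abbrev CategoryTheory.ProjectiveResolution.homOp (P : ProjectiveResolution X)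
    (Y : ModuleCat.{u} R) : ChainComplex (ModuleCat.{u} R)ᵒᵖ ℕ :=
  ((((linearYoneda R (ModuleCat.{u} R)).obj Y).rightOp).mapHomologicalComplex _).obj P.complex

/-- The derived functor `Ext R (ModuleCat R) i` is computed by `homOp`. -/
noncomputable def CategoryTheory.ProjectiveResolution.homOpIso (P : ProjectiveResolution X)
    (Y : ModuleCat.{u} R) (i : ℕ) :
    ((((linearYoneda R (ModuleCat.{u} R)).obj Y).rightOp).leftDerived i).obj X ≅
      (P.homOp Y).homology i :=
  P.isoLeftDerivedObj _ i

/-- The class in `Ext R (ModuleCat R) i` of an element of `(P.homOp Y).opcycles i`, that is, of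
an `i`-cocycle `P.complex.X i ⟶ Y`. -/
noncomputable def CategoryTheory.ProjectiveResolution.derivedExtClass (P : ProjectiveResolution X)
    (Y : ModuleCat.{u} R) (i : ℕ) :
    ((P.homOp Y).opcycles i).unop ⟶ ((Ext R (ModuleCat.{u} R) i).obj (op X)).obj Y :=
  ((P.homOp Y).homologyι i).unop ≫ (P.homOpIso Y i).hom.unop

/-- The cocycle `P.complex.X i ⟶ Y` underlying an element of `(P.homOp Y).opcycles i`. -/
noncomputable def CategoryTheory.ProjectiveResolution.cocycle (P : ProjectiveResolution X)
    (Y : ModuleCat.{u} R) (i : ℕ) (c : ((P.homOp Y).opcycles i).unop) : P.complex.X i ⟶ Y :=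
  ((P.homOp Y).pOpcycles i).unop c

namespace CategoryTheory.ProjectiveResolution

variable (P : ProjectiveResolution X) (P' : ProjectiveResolution X')

lemma derivedExtClass_surjective : Function.Surjective (P.derivedExtClass Y i) := by
  rw [← ModuleCat.epi_iff_surjective]
  exact epi_comp ((P.homOp Y).homologyι i).unop (P.homOpIso Y i).hom.unop

lemma cocycle_injective : Function.Injective (P.cocycle Y i) := by
  have : Mono ((P.homOp Y).pOpcycles i).unop := inferInstance
  exact (ModuleCat.mono_iff_injective _).1 this

lemma d_comp_cocycle (c : ((P.homOp Y).opcycles i).unop) :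
    P.complex.d (i + 1) i ≫ P.cocycle Y i c = 0 := by
  have h := congrArg Quiver.Hom.unop ((P.homOp Y).d_pOpcycles (i + 1) i)
  exact congr($(h) c)

/-- Coboundaries are the image of `fromOpcycles`, whose composite with `homologyι` is zero. -/
lemma derivedExtClass_eq_zero (c : ((P.homOp Y).opcycles (i + 1)).unop)
    (g : P.complex.X i ⟶ Y) (hg : P.complex.d (i + 1) i ≫ g = P.cocycle Y (i + 1) c) :
    P.derivedExtClass Y (i + 1) c = 0 := by
  have h := congrArg Quiver.Hom.unop ((P.homOp Y).p_fromOpcycles (i + 1) i)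
  obtain rfl : ((P.homOp Y).fromOpcycles (i + 1) i).unop g = c := by
    refine P.cocycle_injective (Eq.trans ?_ hg)
    exact congr($(h) g)
  have h' : ((P.homOp Y).fromOpcycles (i + 1) i).unop ≫ P.derivedExtClass Y (i + 1) = 0 := by
    have h₀ := congrArg Quiver.Hom.unop
      ((P.homOp Y).homologyι_comp_fromOpcycles (i + 1) i)
    refine (Category.assoc _ _ _).symm.trans ?_
    exact (congrArg (· ≫ (P.homOpIso Y (i + 1)).hom.unop) h₀).trans zero_comp
  exact congr($(h') g)

variable {P P'}

lemma exists_derivedExtClass_map {g : X' ⟶ X} (φ : Hom P' P g)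
    (c : ((P.homOp Y).opcycles i).unop) :
    ∃ c' : ((P'.homOp Y).opcycles i).unop,
      P'.cocycle Y i c' = φ.hom.f i ≫ P.cocycle Y i c ∧
      P'.derivedExtClass Y i c' =
        ((Ext R (ModuleCat.{u} R) i).map g.op).app Y (P.derivedExtClass Y i c) := by
  let F := ((linearYoneda R (ModuleCat.{u} R)).obj Y).rightOp
  let ψ : P'.homOp Y ⟶ P.homOp Y := (F.mapHomologicalComplex _).map φ.hom
  refine ⟨(HomologicalComplex.opcyclesMap ψ i).unop c, ?_, ?_⟩
  · have h := congrArg Quiver.Hom.unop (HomologicalComplex.p_opcyclesMap ψ i)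
    exact congr($(h) c)
  · have h₁ : (F.leftDerived i).map g ≫ (P.homOpIso Y i).hom =
        (P'.homOpIso Y i).hom ≫ HomologicalComplex.homologyMap ψ i :=
      isoLeftDerivedObj_hom_naturality g P' P φ.hom
        (φ.hom_f_zero_comp_π_f_zero.trans (by rw [ChainComplex.single₀_map_f_zero]; rfl)) F i
    have h₂ : (P'.homOpIso Y i).hom ≫ (P'.homOp Y).homologyι i ≫
        HomologicalComplex.opcyclesMap ψ i =
        (F.leftDerived i).map g ≫ (P.homOpIso Y i).hom ≫ (P.homOp Y).homologyι i := by
      rw [reassoc_of% h₁, HomologicalComplex.homologyι_naturality]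
    have h₃ := congrArg Quiver.Hom.unop h₂
    exact congr($(h₃) c)

end CategoryTheory.ProjectiveResolution

/-- A class of positive degree in the derived functor `Ext R (ModuleCat R)` has a counterpart in
`Abelian.Ext`, such that every map killing the latter kills the former. -/
lemma exists_ext_forall_derivedExt_map_eq_zero (x : ((Ext R (ModuleCat.{u} R) (i + 1)).obj (op X)).obj Y) :
    ∃ ξ : Abelian.Ext X Y (i + 1), ∀ (X' : ModuleCat.{u} R) (g : X' ⟶ X),
      (Abelian.Ext.mk₀ g).comp ξ (zero_add _) = 0 →
        ((Ext R (ModuleCat.{u} R) (i + 1)).map g.op).app Y x = 0 := by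
  let P := projectiveResolution X
  obtain ⟨c, rfl⟩ := P.derivedExtClass_surjective x
  -- One cocycle represents both classes. If `g` kills `ξ`, the cocycle pulled back along a lift of
  -- `g` is a coboundary, which kills `x` as well.
  refine ⟨P.extMk (P.cocycle Y (i + 1) c) (i + 2) rfl (P.d_comp_cocycle c), fun X' g hg ↦ ?_⟩
  let P' := projectiveResolution X'
  let φ : ProjectiveResolution.Hom P' P g := ⟨ProjectiveResolution.lift g P' P,
    (ProjectiveResolution.lift_commutes_zero g P' P).trans
      (by rw [ChainComplex.single₀_map_f_zero]; rfl)⟩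
  obtain ⟨c', hc', h⟩ := ProjectiveResolution.exists_derivedExtClass_map φ c
  rw [ProjectiveResolution.mk₀_comp_extMk _ _ _ _ φ,
    ProjectiveResolution.extMk_eq_zero_iff _ _ _ _ _ i rfl] at hg
  obtain ⟨k, hk⟩ := hg
  rw [← h]
  exact P'.derivedExtClass_eq_zero c' k (hk.trans hc'.symm)

lemma isZero_derivedExt_of_isZero (hY : IsZero Y) :
    IsZero (((Ext R (ModuleCat.{u} R) i).obj (op X)).obj Y) := by
  let P := projectiveResolution X
  have : Subsingleton ((P.homOp Y).opcycles i).unop :=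
    ⟨fun c c' ↦ P.cocycle_injective (hY.eq_of_tgt _ _)⟩
  have := (P.derivedExtClass_surjective (Y := Y) (i := i)).subsingleton
  exact ModuleCat.isZero_of_subsingleton _

end Comparison

/-! ### Vanishing of local cohomology as a colimit. -/

namespace localCohomology

variable {R : Type u} [CommRing R]

/-- Evaluation at `N` preserves the colimit of functors, so maps out of it are determined by the
stages, where each element eventually dies. -/
lemma isZero_obj (a : Ideal R) (i : ℕ) (N : ModuleCat.{u} R)
    (h : ∀ (j : ℕᵒᵖ) (x : ((diagram (idealPowersDiagram a) i).obj (Opposite.op j)).obj N),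
      ∃ (k : ℕᵒᵖ) (f : k ⟶ j), ((diagram (idealPowersDiagram a) i).map f.op).app N x = 0) :
    IsZero ((localCohomology a i).obj N) := by
  have := hasColimitDiagram.{u, 0} (idealPowersDiagram a) i
  rw [IsZero.iff_id_eq_zero]
  change 𝟙 ((colimit (diagram (idealPowersDiagram a) i)).obj N) = 0
  refine (isColimitOfPreserves ((evaluation _ _).obj N) (colimit.isColimit
    (diagram (idealPowersDiagram a) i))).hom_ext fun j ↦ ?_
  ext x
  obtain ⟨k, f, hf⟩ := h j.unop x
  have hw := NatTrans.congr_app (colimit.w (diagram (idealPowersDiagram a) i) f.op) N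
  have hx : (colimit.ι (diagram (idealPowersDiagram a) i) j).app N x = 0 := by
    have := congr($(hw) x)
    refine this.symm.trans ?_
    refine (ModuleCat.comp_apply _ _ _).trans ?_
    rw [hf, map_zero]
  simpa using hx

lemma isZero_obj_of_isZero (a : Ideal R) (i : ℕ) {N : ModuleCat.{u} R} (hN : IsZero N) :
    IsZero ((localCohomology a i).obj N) :=
  isZero_obj a i N fun j x ↦ ⟨j, 𝟙 j, by
    have h : IsZero (((diagram (idealPowersDiagram a) i).obj (Opposite.op j)).obj N) :=
      isZero_derivedExt_of_isZero hN
    rw [(ModuleCat.subsingleton_of_isZero h).elim x 0, map_zero]⟩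

lemma isZero_obj_of_extEventuallyZero (a : Ideal R) (i : ℕ) (hi : 1 ≤ i) {N : ModuleCat.{u} R}
    (h : (ringModIdeals (idealPowersDiagram a)).ExtEventuallyZero i N) :
    IsZero ((localCohomology a i).obj N) := by
  obtain ⟨i, rfl⟩ := Nat.exists_eq_add_of_le' hi
  refine isZero_obj a _ N fun j x ↦ ?_
  obtain ⟨ξ, hξ⟩ := exists_ext_forall_derivedExt_map_eq_zero x
  obtain ⟨k, f, hf⟩ := h j ξ
  exact ⟨k, f, hξ _ _ hf⟩

end localCohomology

/-! ### Extended-real bounds attained at integers. -/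

section IntegerBounds

variable {p : ℤ → Prop}

lemma exists_isGreatest_of_sSup_ne_top (hp : ∃ i, p i)
    (h : sSup {x : EReal | ∃ i : ℤ, p i ∧ x = ((i : ℝ) : EReal)} ≠ ⊤) :
    ∃ m : ℤ, p m ∧ (∀ i, p i → i ≤ m) ∧
      sSup {x : EReal | ∃ i : ℤ, p i ∧ x = ((i : ℝ) : EReal)} = ((m : ℝ) : EReal) := by
  set S := {x : EReal | ∃ i : ℤ, p i ∧ x = ((i : ℝ) : EReal)}
  obtain ⟨b, hb⟩ : ∃ b : ℤ, ∀ i, p i → i ≤ b := by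
    obtain ⟨r, hr⟩ := EReal.exists_rat_btwn_of_lt (lt_top_iff_ne_top.2 h)
    refine ⟨⌈r⌉, fun i hi ↦ ?_⟩
    have h₁ : ((i : ℝ) : EReal) ≤ sSup S := le_sSup ⟨i, hi, rfl⟩
    have h₂ : ((i : ℝ) : EReal) < (((r : ℚ) : ℝ) : EReal) := h₁.trans_lt hr.1
    have h₃ : (i : ℚ) < r := by exact_mod_cast h₂
    exact_mod_cast (h₃.le.trans (Int.le_ceil r))
  obtain ⟨m, hm, hmax⟩ := Int.exists_greatest_of_bdd ⟨b, hb⟩ hp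
  refine ⟨m, hm, hmax, le_antisymm (sSup_le ?_) (le_sSup ⟨m, hm, rfl⟩)⟩
  rintro _ ⟨i, hi, rfl⟩
  exact_mod_cast hmax i hi

lemma exists_isLeast_of_sInf_ne_bot (hp : ∃ i, p i)
    (h : sInf {x : EReal | ∃ i : ℤ, p i ∧ x = ((i : ℝ) : EReal)} ≠ ⊥) :
    ∃ m : ℤ, p m ∧ (∀ i, p i → m ≤ i) ∧
      sInf {x : EReal | ∃ i : ℤ, p i ∧ x = ((i : ℝ) : EReal)} = ((m : ℝ) : EReal) := by
  set S := {x : EReal | ∃ i : ℤ, p i ∧ x = ((i : ℝ) : EReal)}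
  obtain ⟨b, hb⟩ : ∃ b : ℤ, ∀ i, p i → b ≤ i := by
    obtain ⟨r, hr⟩ := EReal.exists_rat_btwn_of_lt (bot_lt_iff_ne_bot.2 h)
    refine ⟨⌊r⌋, fun i hi ↦ ?_⟩
    have h₁ : sInf S ≤ ((i : ℝ) : EReal) := sInf_le ⟨i, hi, rfl⟩
    have h₂ : (((r : ℚ) : ℝ) : EReal) < ((i : ℝ) : EReal) := hr.2.trans_le h₁
    have h₃ : r < (i : ℚ) := by exact_mod_cast h₂
    exact_mod_cast ((Int.floor_le r).trans h₃.le)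
  obtain ⟨m, hm, hmin⟩ := Int.exists_least_of_bdd ⟨b, hb⟩ hp
  refine ⟨m, hm, hmin, le_antisymm (sInf_le ⟨m, hm, rfl⟩) (le_sInf ?_)⟩
  rintro _ ⟨i, hi, rfl⟩
  exact_mod_cast hmin i hi

end IntegerBounds

/-! ### Quasi-injective resolutions and the dimension bound. -/

namespace QuasiInjective

attribute [local instance] Abelian.hasFiniteBiproducts

variable {A : Type u} [Category.{v} A] [Abelian A] {I : ChainComplex A ℤ} {N : A}

lemma isZero_X_of_csup_lt {i : ℤ} (h : csup I < ((i : ℝ) : EReal)) : IsZero (I.X i) := by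
  by_contra hi
  exact absurd (le_sSup ⟨i, hi, rfl⟩ : ((i : ℝ) : EReal) ≤ csup I) (not_le.2 h)

namespace IsQuasiInjectiveResolution

variable (hI : IsQuasiInjectiveResolution I N)

include hI

/-- Including the degrees above `csup I`, the homology is a finite direct sum of copies of `N`. -/
lemma exists_homology_iso (i : ℤ) :
    ∃ b : ℕ, Nonempty (I.homology i ≅ ⨁ (fun _ : Fin b => N)) := by
  obtain ⟨b, _, hb⟩ := hI.homology
  obtain h | h := le_or_gt ((i : ℝ) : EReal) (csup I)
  · exact ⟨b i, hb i h⟩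
  · refine ⟨0, ⟨(ChainComplex.isZero_homology (isZero_X_of_csup_lt h)).iso ?_⟩⟩
    rw [IsZero.iff_id_eq_zero]
    ext a
    exact a.elim0

lemma exists_not_isZero_homology (hN : ¬ IsZero N) : ∃ i, ¬ IsZero (I.homology i) := by
  obtain ⟨b, ⟨i, hi, hbi⟩, hb⟩ := hI.homology
  refine ⟨i, fun h ↦ hN ?_⟩
  obtain ⟨e⟩ := hb i hi
  have : NeZero (b i) := ⟨hbi⟩
  exact (h.of_iso e.symm).of_mono (biproduct.ι (fun _ : Fin (b i) => N) 0)

section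

variable [HasExt A] {J : Type*} [Category* J] {D : J ⥤ A}

lemma extEventuallyZero_homology {i : ℤ} {k : ℕ} (h : D.ExtEventuallyZero k N) :
    D.ExtEventuallyZero k (I.homology i) := by
  obtain ⟨b, ⟨e⟩⟩ := hI.exists_homology_iso i
  exact (Functor.ExtEventuallyZero.biproduct fun _ ↦ h).of_iso e

/-- Non-zero homology contains at least one copy of `N`, as a direct summand. -/
lemma extEventuallyZero_of_homology {i : ℤ} {k : ℕ} (hi : ¬ IsZero (I.homology i))
    (h : D.ExtEventuallyZero k (I.homology i)) : D.ExtEventuallyZero k N := by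
  obtain ⟨b, ⟨e⟩⟩ := hI.exists_homology_iso i
  obtain rfl | hb := Nat.eq_zero_or_pos b
  · refine absurd ?_ hi
    rw [IsZero.iff_id_eq_zero, ← cancel_mono e.hom]
    ext a
    exact a.elim0
  · exact (h.of_iso e.symm).of_biproduct ⟨0, hb⟩

end

lemma exists_csup (hN : ¬ IsZero N) : ∃ s : ℤ, (∀ i, s < i → IsZero (I.X i)) ∧
    csup I = ((s : ℝ) : EReal) := by
  obtain ⟨i, hi⟩ := hI.exists_not_isZero_homology hN
  obtain ⟨s, _, hs, h⟩ := exists_isGreatest_of_sSup_ne_top (p := fun i ↦ ¬ IsZero (I.X i))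
    ⟨i, fun h ↦ hi (ChainComplex.isZero_homology h)⟩ hI.boundedAbove.ne
  exact ⟨s, fun i hi ↦ by_contra fun h ↦ not_le.2 hi (hs i h), h⟩

lemma exists_hsup (hN : ¬ IsZero N) : ∃ t : ℤ, ¬ IsZero (I.homology t) ∧
    (∀ i, t < i → IsZero (I.homology i)) ∧ hsup I = ((t : ℝ) : EReal) := by
  have hle : hsup I ≤ csup I := sSup_le_sSup (by
    rintro _ ⟨i, hi, rfl⟩
    exact ⟨i, fun h ↦ hi (ChainComplex.isZero_homology h), rfl⟩)
  obtain ⟨t, ht, hmax, h⟩ := exists_isGreatest_of_sSup_ne_top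
    (p := fun i ↦ ¬ IsZero (I.homology i)) (hI.exists_not_isZero_homology hN)
    (hle.trans_lt hI.boundedAbove).ne
  exact ⟨t, ht, fun i hi ↦ by_contra fun h ↦ not_le.2 hi (hmax i h), h⟩

lemma exists_cinf_hinf (hN : ¬ IsZero N) (hbot : cinf I ≠ ⊥) :
    ∃ l h : ℤ, (∀ i, i < l → IsZero (I.X i)) ∧ cinf I = ((l : ℝ) : EReal) ∧
      ¬ IsZero (I.homology h) ∧ (∀ i, i < h → IsZero (I.homology i)) ∧ l ≤ h ∧
      hinf I - cinf I = (((h - l : ℤ) : ℝ) : EReal) := by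
  have hle : cinf I ≤ hinf I := sInf_le_sInf (by
    rintro _ ⟨i, hi, rfl⟩
    exact ⟨i, fun h ↦ hi (ChainComplex.isZero_homology h), rfl⟩)
  obtain ⟨i, hi⟩ := hI.exists_not_isZero_homology hN
  obtain ⟨l, _, hl, hcinf⟩ := exists_isLeast_of_sInf_ne_bot (p := fun i ↦ ¬ IsZero (I.X i))
    ⟨i, fun h ↦ hi (ChainComplex.isZero_homology h)⟩ hbot
  obtain ⟨h, hh, hmin, hhinf⟩ := exists_isLeast_of_sInf_ne_bot
    (p := fun i ↦ ¬ IsZero (I.homology i)) ⟨i, hi⟩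
    ((bot_lt_iff_ne_bot.2 hbot).trans_le hle).ne'
  refine ⟨l, h, fun i hi ↦ by_contra fun h ↦ not_le.2 hi (hl i h), hcinf, hh,
    fun i hi ↦ by_contra fun h ↦ not_le.2 hi (hmin i h),
    hl h fun h' ↦ hh (ChainComplex.isZero_homology h'), ?_⟩
  rw [show hinf I = _ from hhinf, show cinf I = _ from hcinf, Int.cast_sub, EReal.coe_sub]

lemma cinf_ne_bot (hN : ¬ IsZero N) (hb : IsBounded I) : cinf I ≠ ⊥ := by
  intro h
  obtain ⟨s, _, hs⟩ := hI.exists_csup hN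
  simp [IsBounded, QuasiInjective.length, h, hs] at hb

end IsQuasiInjectiveResolution

lemma qid_of_not_isZero (hN : ¬ IsZero N) :
    qid N = sInf {x : EReal | ∃ I : ChainComplex A ℤ,
      IsQuasiInjectiveResolution I N ∧ IsBounded I ∧ x = hinf I - cinf I} := if_neg hN

lemma qid_nonneg (hN : ¬ IsZero N) : 0 ≤ qid N := by
  rw [qid_of_not_isZero hN]
  refine le_sInf ?_
  rintro _ ⟨I, hI, hb, rfl⟩
  obtain ⟨l, h, _, _, _, _, hlh, heq⟩ := hI.exists_cinf_hinf hN (hI.cinf_ne_bot hN hb)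
  rw [heq]
  exact_mod_cast sub_nonneg.2 hlh

variable [HasExt A] {J : Type*} [Category* J] {D : J ⥤ A}

/-- If `Ext` into `N` vanishes eventually in large degrees, it does so in degrees `> qid N`. -/
theorem extEventuallyZero_of_qid_lt (hN : ¬ IsZero N) {m : ℕ}
    (hm : ∀ k, m ≤ k → D.ExtEventuallyZero k N) {i : ℕ} (hi : qid N < (i : EReal)) :
    D.ExtEventuallyZero i N := by
  rw [qid_of_not_isZero hN, sInf_lt_iff] at hi
  obtain ⟨_, ⟨I, hI, hb, rfl⟩, hi⟩ := hi
  obtain ⟨s, hs, -⟩ := hI.exists_csup hN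
  obtain ⟨l, h, hl, -, hh, hmin, -, heq⟩ := hI.exists_cinf_hinf hN (hI.cinf_ne_bot hN hb)
  have := hI.injective
  refine Functor.ExtEventuallyZero.of_boundedComplex hs hl
    (fun _ _ ↦ hI.extEventuallyZero_homology) hmin
    (fun _ ↦ hI.extEventuallyZero_of_homology hh) hm ?_
  rw [heq, ← EReal.coe_natCast] at hi
  exact_mod_cast hi

/-- If `Ext` into `N` vanishes eventually in the degrees `n ≤ i ≤ n - inf I`, it does so in all
degrees `≥ n`. -/
theorem extEventuallyZero_of_window (hN : ¬ IsZero N) (hqid : qid N < ⊤)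
    (hI : IsQuasiInjectiveResolution I N) (heq : qid N = hinf I - cinf I) (hsup : hsup I ≤ 0)
    {n : ℕ} (hn : 1 ≤ n) (hw : ∀ i : ℕ, n ≤ i → (i : EReal) ≤ (n : EReal) - cinf I →
      D.ExtEventuallyZero i N) (i : ℕ) (hi : n ≤ i) : D.ExtEventuallyZero i N := by
  -- If `inf I = -∞`, then `hinf I - inf I` is `⊤`, against finiteness of `qid N`, unless `hinf I =
  -- ⊥`; then the convention `⊥ + ⊤ = ⊥` contradicts `qid N ≥ 0`.
  have hbot : cinf I ≠ ⊥ := by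
    intro h
    rw [h] at heq
    obtain hinf' | hinf' := eq_or_ne (hinf I) ⊥
    · have := qid_nonneg hN
      simp [heq, hinf'] at this
    · rw [heq, sub_eq_add_neg, EReal.neg_bot, EReal.add_top_of_ne_bot hinf'] at hqid
      exact lt_irrefl _ hqid
  obtain ⟨s, hs, -⟩ := hI.exists_csup hN
  obtain ⟨t, ht, hmax, hteq⟩ := hI.exists_hsup hN
  obtain ⟨l, -, hl, hcinf, -⟩ := hI.exists_cinf_hinf hN hbot
  have := hI.injective
  refine Functor.ExtEventuallyZero.of_window hs hl
    (fun _ _ ↦ hI.extEventuallyZero_homology) (t := t) ?_ hmax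
    (fun _ ↦ hI.extEventuallyZero_of_homology ht) hn (fun k hk hkl ↦ hw k hk ?_) i hi
  · rw [hteq] at hsup
    exact_mod_cast hsup
  · rw [hcinf, ← EReal.coe_natCast, ← EReal.coe_natCast, ← EReal.coe_sub]
    exact_mod_cast hkl

end QuasiInjective

theorem proposition3p4 {R : Type u} [CommRing R] [IsNoetherianRing R]
    (M N : ModuleCat.{u} R) (hN : QuasiInjective.qid N < ⊤) :
    (∀ I : ChainComplex (ModuleCat.{u} R) ℤ,
      QuasiInjective.IsQuasiInjectiveResolution I N →
      QuasiInjective.qid N = QuasiInjective.hinf I - QuasiInjective.cinf I →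
      QuasiInjective.hsup I ≤ 0 →
      ∀ n : ℕ, 1 ≤ n →
        (∀ i : ℕ, n ≤ i → (i : EReal) ≤ (n : EReal) - QuasiInjective.cinf I →
          Subsingleton (Abelian.Ext M N i)) →
        ∀ i : ℕ, n ≤ i → Subsingleton (Abelian.Ext M N i)) ∧
    ((∃ m : ℕ, ∀ i : ℕ, m ≤ i → Subsingleton (Abelian.Ext M N i)) →
      ∀ i : ℕ, QuasiInjective.qid N < (i : EReal) → Subsingleton (Abelian.Ext M N i)) ∧
    (∀ (a : Ideal R) (i : ℕ), QuasiInjective.qid N < (i : EReal) →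
      IsZero ((localCohomology a i).obj N)) := by
  -- For `N = 0` the dimension is `⊥` and a resolution need not have any homology; all the groups
  -- vanish directly.
  by_cases hN₀ : IsZero N
  · have h₀ (i : ℕ) : Subsingleton (Abelian.Ext M N i) :=
      (Functor.extEventuallyZero_const_iff (J := Discrete Unit) M N i).1
        (Functor.ExtEventuallyZero.of_isZero hN₀)
    exact ⟨fun _ _ _ _ _ _ _ i _ ↦ h₀ i, fun _ i _ ↦ h₀ i,
      fun a i _ ↦ localCohomology.isZero_obj_of_isZero a i hN₀⟩
  refine ⟨fun I hI heq hsup n hn hw i hi ↦ ?_, fun ⟨m, hm⟩ i hi ↦ ?_, fun a i hi ↦ ?_⟩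
  · simp only [← Functor.extEventuallyZero_const_iff (J := Discrete Unit)] at hw ⊢
    exact QuasiInjective.extEventuallyZero_of_window hN₀ hN hI heq hsup hn hw i hi
  · simp only [← Functor.extEventuallyZero_const_iff (J := Discrete Unit)] at hm ⊢
    exact QuasiInjective.extEventuallyZero_of_qid_lt hN₀ hm hi
  -- The comparison with local cohomology needs a positive degree, which `0 ≤ qid N < i` provides.
  · have hi₀ : 0 < i := by
      have := (QuasiInjective.qid_nonneg hN₀).trans_lt hi
      exact_mod_cast this
    obtain ⟨m, hm⟩ := Ideal.exists_forall_extEventuallyZero a N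
    exact localCohomology.isZero_obj_of_extEventuallyZero a i hi₀
      (QuasiInjective.extEventuallyZero_of_qid_lt hN₀ hm hi)
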